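/- A $3$-graph is a collection of $3$-element subsets (edges) of a vertex set. Let $K_t^3$ be the complete $3$-graph on $t$ vertices, and for $s\ge 3$ let the tight cycle $C_s^3$ be the $3$-graph with vertex set $\mathbb{Z}/s\mathbb{Z}$ and edges $\{i,i+1,i+2\}$, $i\in\mathbb{Z}/s\mathbb{Z}$. For $3$-graphs $F,G$, the Ramsey number $r(F,G)$ is the minimum $n$ such that every red/blue coloring of the edges of $K_n^3$ contains a red copy of $F$ or a blue copy of $G$. **Theorem.** Fix $s\ge 5$ with $s\not\equiv 0 \pmod 3$. There are positive constants $a$ and $b$ (depending only on $s$) such that for all integers $t\ge 2$, $$2^{at} < r(C_s^3,K_t^3) < 2^{b t^2\log t}.$$ -/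

import Mathlib

/-- A `k`-uniform hypergraph with vertex set `V`: a collection of `k`-element subsets of `V`. -/
@[ext]
structure KGraph (k : ℕ) (V : Type*) where
  /-- the edges -/
  edges : Set (Finset V)
  /-- every edge has exactly `k` vertices -/
  uniform : ∀ e ∈ edges, e.card = k

namespace KGraph

/-- The complete `k`-graph `K_n^k`, on the vertex set `Fin n`. -/
def complete (k n : ℕ) : KGraph k (Fin n) where
  edges := {e | e.card = k}
  uniform := fun _ he => he

/-- The `k`-sets that are not edges of `H`. -/
def compl {k : ℕ} {V : Type*} (H : KGraph k V) : KGraph k V where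
  edges := {e | e.card = k ∧ e ∉ H.edges}
  uniform := fun _ he => he.1

/-- `H` contains a copy of `F`: an injection of the vertices that maps edges to edges. -/
def ContainsCopy {k : ℕ} {V W : Type*} (H : KGraph k W) (F : KGraph k V) : Prop :=
  ∃ f : V ↪ W, ∀ e ∈ F.edges, e.map f ∈ H.edges

/-- The cyclic interval `{i, i + 1, …, i + k - 1}` of `ZMod s`. -/
def cyclicInterval (k s : ℕ) (i : ZMod s) : Finset (ZMod s) :=
  (Finset.range k).image fun j : ℕ => i + (j : ZMod s)

theorem card_cyclicInterval {k s : ℕ} (h : k ≤ s) (i : ZMod s) :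
    (cyclicInterval k s i).card = k := by
  unfold cyclicInterval
  rw [Finset.card_image_of_injOn, Finset.card_range]
  intro a ha b hb hab
  have ha' : a < k := by simpa using ha
  have hb' : b < k := by simpa using hb
  have hab' : (a : ZMod s) = (b : ZMod s) := add_left_cancel hab
  rw [ZMod.natCast_eq_natCast_iff] at hab'
  exact Nat.ModEq.eq_of_lt_of_lt hab' (ha'.trans_le h) (hb'.trans_le h)

/-- The tight cycle `C_s^k` for `s ≥ k`: its vertices are the integers modulo `s` and its edges
are the cyclic intervals of `k` consecutive vertices. -/
def tightCycle (k s : ℕ) (h : k ≤ s) : KGraph k (ZMod s) where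
  edges := Set.range (cyclicInterval k s)
  uniform := by
    rintro _ ⟨i, rfl⟩
    exact card_cyclicInterval h i

/-- Every red/blue colouring of the edges of `K_n^k` has a red copy of `F` or a blue copy of `G`.
A colouring is given by its `k`-graph `R` of red edges; the blue edges are the other `k`-sets. -/
def Arrows {k : ℕ} {V W : Type*} (n : ℕ) (F : KGraph k V) (G : KGraph k W) : Prop :=
  ∀ R : KGraph k (Fin n), R.ContainsCopy F ∨ R.compl.ContainsCopy G

/-- The Ramsey number `r(F, G)`: the minimum `n` such that every red/blue colouring of `K_n^k`
has a red copy of `F` or a blue copy of `G`. (The value is `0` if there is no such `n`.) -/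
noncomputable def ramsey {k : ℕ} {V W : Type*} (F : KGraph k V) (G : KGraph k W) : ℕ :=
  sInf {n | Arrows n F G}

end KGraph

/-!
For the lower bound, let `r : V × V → Fin 3` be random and colour a triple red if its vertices can
be given distinct roles such that `r (x, y)` is the role of `x` for all `x` and `y` in the triple.
Two triples `xyz` and `yzw` that are both red give `x` and `w` the same role, so the roles along a
red tight cycle have period `3` and the length of the cycle is divisible by `3`. A blue set of `3m`
vertices contains `m ^ 2` triples no two of which share a pair, and each of them is red with
probability at least `3 ^ (-6) = 1 / 729`, independently of the others. So a given set is blue with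
probability `exp (-Ω(m ^ 2))`, and the union bound over all sets leaves room for exponentially many
vertices.

For the upper bound, replace `C_s` by a fixed `3`-graph `D` on five vertices containing tight cycles
of lengths `4` and `5`. Exposing the vertices one at a time, and keeping at every exposure the most
popular colour pattern towards the remaining vertices, costs a factor `t ^ 3` and extends one of at
most `t + 1` blue lists; this can happen fewer than `t ^ 2` times, so `N = t ^ (3 * t ^ 2)` vertices
suffice for a red `D` or a blue `K_t`. Walking around the two cycles maps `C_s` homomorphically to
`D`, so a red blow-up of `D` contains `C_s`. To find one on the vertex set `Fin N × X`, look at the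
graphs of all functions `g : Fin N → X`: each spans a red copy of `D` unless there is a blue `K_t`,
so some five columns carry at least a proportion `N ^ (-5)` of all possible copies, and a
`5`-partite `5`-graph of that density contains a complete `5`-partite one if `X` is of size
polynomial in `N`.
-/

open Finset

section Counting

section Restriction

variable {α β P K X : Type*} [Fintype α] [Fintype β] [Fintype P] [Fintype K] [Fintype X]

theorem card_filter_comp_mem [DecidableEq α] [DecidableEq X] (e : β ↪ α) (E : Finset (β → X)) :
    #{c : α → X | c ∘ e ∈ E} * Fintype.card X ^ Fintype.card β =
      #E * Fintype.card X ^ Fintype.card α := by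
  classical
  let restrict : (α → X) ≃ (β → X) × ({a // a ∉ Set.range e} → X) :=
    (Equiv.piEquivPiSubtypeProd (· ∈ Set.range e) fun _ => X).trans
      (((Equiv.ofInjective e e.injective).symm.arrowCongr (.refl X)).prodCongr (.refl _))
  have hfilter : #{c : α → X | c ∘ e ∈ E} =
      #(E ×ˢ (univ : Finset ({a // a ∉ Set.range e} → X))) :=
    card_equiv restrict fun c => by
      simp only [mem_filter, mem_univ, true_and, mem_product, and_true]
      rfl
  have hcompl : Fintype.card {a // a ∉ Set.range e} + Fintype.card β = Fintype.card α := by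
    rw [← Set.card_range_of_injective e.injective, add_comm, ← Fintype.card_sum]
    exact Fintype.card_congr (Equiv.sumCompl (· ∈ Set.range e))
  rw [hfilter, card_product, card_univ, Fintype.card_fun, mul_assoc, ← pow_add, hcompl]

theorem card_filter_forall_exists_ne [DecidableEq α] [DecidableEq X] (e : P × K ↪ α) (τ : K → X) :
    #{c : α → X | ∀ p, ∃ k, c (e (p, k)) ≠ τ k} *
        (Fintype.card X ^ Fintype.card K) ^ Fintype.card P =
      (Fintype.card X ^ Fintype.card K - 1) ^ Fintype.card P *
        Fintype.card X ^ Fintype.card α := by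
  classical
  have hmiss : #{h : P × K → X | ∀ p, ∃ k, h (p, k) ≠ τ k} =
      (Fintype.card X ^ Fintype.card K - 1) ^ Fintype.card P :=
    calc #{h : P × K → X | ∀ p, ∃ k, h (p, k) ≠ τ k}
        = #(Fintype.piFinset fun _ : P => univ.erase τ) :=
          card_equiv (Equiv.curry P K X) fun h => by
            simp [Fintype.mem_piFinset, Function.ne_iff]
      _ = _ := by simp [Fintype.card_piFinset]
  have h := card_filter_comp_mem e {h : P × K → X | ∀ p, ∃ k, h (p, k) ≠ τ k}
  rw [hmiss, Fintype.card_prod, mul_comm (Fintype.card P), pow_mul] at h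
  simpa using h

theorem exists_forall_exists_forall_eq {α Γ : Type*} [Finite α] [Fintype Γ] [Nonempty X]
    (e : Γ → P × K ↪ α) (τ : K → X)
    (h : Fintype.card Γ * (Fintype.card X ^ Fintype.card K - 1) ^ Fintype.card P <
      (Fintype.card X ^ Fintype.card K) ^ Fintype.card P) :
    ∃ c : α → X, ∀ γ, ∃ p, ∀ k, c (e γ (p, k)) = τ k := by
  classical
  cases nonempty_fintype α
  by_contra! hbad
  set q := Fintype.card X ^ Fintype.card K
  have hcover : (univ : Finset (α → X)) ⊆
      univ.biUnion fun γ => {c | ∀ p, ∃ k, c (e γ (p, k)) ≠ τ k} := fun c _ => by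
    simpa using hbad c
  have hunion : Fintype.card X ^ Fintype.card α ≤
      ∑ γ, #{c : α → X | ∀ p, ∃ k, c (e γ (p, k)) ≠ τ k} := by
    simpa using (card_le_card hcover).trans card_biUnion_le
  have hle := calc
    q ^ Fintype.card P * Fintype.card X ^ Fintype.card α
        ≤ q ^ Fintype.card P * ∑ γ, #{c : α → X | ∀ p, ∃ k, c (e γ (p, k)) ≠ τ k} := by gcongr
    _ = ∑ _γ : Γ, (q - 1) ^ Fintype.card P * Fintype.card X ^ Fintype.card α := by
        rw [mul_comm, sum_mul]
        exact sum_congr rfl fun γ _ => card_filter_forall_exists_ne (e γ) τ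
    _ = Fintype.card Γ * (q - 1) ^ Fintype.card P * Fintype.card X ^ Fintype.card α := by
        simp [mul_assoc]
  exact h.not_ge (Nat.le_of_mul_le_mul_right hle (by positivity))

theorem exists_card_pow_le_card_mul [Nonempty X] (E : (β ↪ α) → Finset (β → X))
    (h : ∀ g : α → X, ∃ p, g ∘ p ∈ E p) :
    ∃ p, Fintype.card X ^ Fintype.card β ≤ #(E p) * Fintype.card α ^ Fintype.card β := by
  classical
  have hcover : (univ : Finset (α → X)) ⊆ univ.biUnion fun p => {g | g ∘ p ∈ E p} := fun g _ => by
    simpa using h g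
  have hunion : Fintype.card X ^ Fintype.card α ≤ ∑ p, #{g : α → X | g ∘ p ∈ E p} := by
    simpa using (card_le_card hcover).trans card_biUnion_le
  have hsum : Fintype.card X ^ Fintype.card β ≤ ∑ p, #(E p) := by
    refine Nat.le_of_mul_le_mul_right ?_ (by positivity : 0 < Fintype.card X ^ Fintype.card α)
    calc Fintype.card X ^ Fintype.card β * Fintype.card X ^ Fintype.card α
        ≤ Fintype.card X ^ Fintype.card β * ∑ p, #{g : α → X | g ∘ p ∈ E p} := by gcongr
      _ = (∑ p, #(E p)) * Fintype.card X ^ Fintype.card α := by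
        rw [mul_comm, sum_mul, sum_mul]
        exact sum_congr rfl fun p _ => card_filter_comp_mem p (E p)
  have hcard : Fintype.card (β ↪ α) ≤ Fintype.card α ^ Fintype.card β := by
    rw [Fintype.card_embedding_eq]
    exact Nat.descFactorial_le_pow _ _
  obtain ⟨p₀, -⟩ := h fun _ => Classical.arbitrary X
  obtain ⟨p, -, hp⟩ := exists_le_of_sum_le (s := univ)
    (f := fun _ : β ↪ α => Fintype.card X ^ Fintype.card β)
    (g := fun p => #(E p) * Fintype.card α ^ Fintype.card β) ⟨p₀, mem_univ p₀⟩ <| by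
      rw [sum_const, card_univ, smul_eq_mul, ← sum_mul, mul_comm]
      exact Nat.mul_le_mul hsum hcard
  exact ⟨p, hp⟩

end Restriction

section CommonNeighbours

variable {α β : Type*}

theorem exists_card_le_mul_card_filter_or (r : α → β → Prop)
    [∀ a, DecidablePred (r a)] (X : Finset α) (S : Finset β) {t : ℕ} (hX : #X < t) :
    (∃ x ∈ X, #S ≤ t * #{z ∈ S | r x z}) ∨ #S ≤ t * #{z ∈ S | ∀ x ∈ X, ¬ r x z} := by
  classical
  by_contra! ⟨hr, hb⟩
  have hcover : S ⊆ {z ∈ S | ∀ x ∈ X, ¬ r x z} ∪ X.biUnion fun x => {z ∈ S | r x z} := by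
    intro z hz
    by_cases h : ∃ x ∈ X, r x z <;> simp_all
  have hle : #S ≤ #{z ∈ S | ∀ x ∈ X, ¬ r x z} + ∑ x ∈ X, #{z ∈ S | r x z} :=
    (card_le_card hcover).trans ((card_union_le _ _).trans (by gcongr; exact card_biUnion_le))
  have hlt := calc
    t * #S ≤ t * #{z ∈ S | ∀ x ∈ X, ¬ r x z} + ∑ x ∈ X, t * #{z ∈ S | r x z} := by
        rw [← mul_sum, ← mul_add]
        gcongr
    _ < #S + ∑ _x ∈ X, #S := add_lt_add_of_lt_of_le hb (sum_le_sum fun x hx => (hr x hx).le)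
    _ = (#X + 1) * #S := by simp [add_mul, add_comm]
  exact hlt.not_ge (Nat.mul_le_mul_right _ hX)

theorem card_le_two_mul_card_filter {s : Finset β} {d : β → ℕ} {D x : ℕ} (hx : 0 < x)
    (hd : ∀ b ∈ s, d b ≤ x) (h : #s * x ≤ D * ∑ b ∈ s, d b) :
    #s ≤ 2 * D * #{b ∈ s | x ≤ 2 * D * d b} := by
  have hpopular : ∑ b ∈ s with x ≤ 2 * D * d b, d b ≤ #{b ∈ s | x ≤ 2 * D * d b} * x :=
    sum_le_card_nsmul _ _ _ fun b hb => hd b (mem_filter.1 hb).1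
  have hunpopular : ∑ b ∈ s with ¬ x ≤ 2 * D * d b, 2 * D * d b ≤ #s * x :=
    calc ∑ b ∈ s with ¬ x ≤ 2 * D * d b, 2 * D * d b
        ≤ #{b ∈ s | ¬ x ≤ 2 * D * d b} * x :=
          sum_le_card_nsmul _ _ _ fun b hb => (not_le.1 (mem_filter.1 hb).2).le
      _ ≤ #s * x := by gcongr; exact filter_subset _ _
  rw [← mul_sum] at hunpopular
  rw [← sum_filter_add_sum_filter_not s (fun b => x ≤ 2 * D * d b)] at h
  refine Nat.le_of_mul_le_mul_right ?_ hx
  linarith [Nat.mul_le_mul_left (2 * D) hpopular]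

variable [Fintype α] (r : α → β → Prop) [∀ a, DecidablePred (r a)]

theorem exists_card_eq_and_card_le_pow_mul [Nonempty α] {T : Finset β} (hT : T.Nonempty)
    {K m : ℕ} (h : ∀ b ∈ T, Fintype.card α + K * m ≤ K * #{a | r a b}) :
    ∃ A : Finset α, ∃ B ⊆ T, #A = m ∧ #T ≤ K ^ m * #B ∧ ∀ a ∈ A, ∀ b ∈ B, r a b := by
  classical
  induction m with
  | zero => exact ⟨∅, T, by simp⟩
  | succ m ih =>
    obtain ⟨A, B, hBT, hA, hTB, hAB⟩ := ih fun b hb => (h b hb).trans' (by gcongr; omega)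
    have hdeg : ∀ b ∈ T, Fintype.card α ≤ K * #(Aᶜ.bipartiteBelow r b) := fun b hb => by
      have hsplit : #{a | r a b} ≤ #A + #(Aᶜ.bipartiteBelow r b) := by
        refine (card_le_card fun a ha => ?_).trans (card_union_le _ _)
        by_cases haA : a ∈ A <;> simp_all
      rw [hA] at hsplit
      nlinarith [h b hb, Nat.mul_le_mul_left K hsplit]
    have hne : Aᶜ.Nonempty := by
      obtain ⟨b, hb⟩ := hT
      by_contra! hempty
      have hα := hdeg b hb
      simp [hempty, bipartiteBelow] at hα
    obtain ⟨a, ha, hBa⟩ := exists_le_of_sum_le (f := fun _ => #B)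
      (g := fun a => K * #(B.bipartiteAbove r a)) hne <| by
        rw [← mul_sum, sum_card_bipartiteAbove_eq_sum_card_bipartiteBelow, mul_sum]
        calc ∑ _a ∈ Aᶜ, #B ≤ #B * Fintype.card α := by
              rw [sum_const, smul_eq_mul, mul_comm]
              gcongr
              exact card_le_univ _
          _ ≤ _ := card_nsmul_le_sum _ _ _ fun b hb => hdeg b (hBT hb)
    refine ⟨insert a A, B.bipartiteAbove r a, (filter_subset _ _).trans hBT,
      by rw [card_insert_of_notMem (mem_compl.1 ha), hA], ?_, ?_⟩
    · rw [pow_succ, mul_assoc]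
      exact hTB.trans (by gcongr)
    · simp +contextual [bipartiteAbove, hAB]

theorem exists_card_eq_and_card_le_pow_succ_mul [Fintype β] [Nonempty α] [Nonempty β] {D m : ℕ}
    (hD : Fintype.card β * Fintype.card α ≤ D * ∑ b, #{a | r a b})
    (hm : 4 * D * m ≤ Fintype.card α) :
    ∃ (A : Finset α) (B : Finset β), #A = m ∧ Fintype.card β ≤ (4 * D) ^ (m + 1) * #B ∧
      ∀ a ∈ A, ∀ b ∈ B, r a b := by
  have hpopular : Fintype.card β ≤
      2 * D * #{b : β | Fintype.card α ≤ 2 * D * #{a | r a b}} :=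
    card_le_two_mul_card_filter Fintype.card_pos (fun b _ => card_le_univ _) hD
  have hne : ({b | Fintype.card α ≤ 2 * D * #{a | r a b}} : Finset β).Nonempty := by
    rw [← card_pos]
    exact Nat.pos_of_mul_pos_left (Fintype.card_pos.trans_le hpopular)
  obtain ⟨A, B, -, hA, hB, hAB⟩ := exists_card_eq_and_card_le_pow_mul r hne (K := 4 * D) (m := m)
    fun b hb => by linarith [(mem_filter.1 hb).2]
  refine ⟨A, B, hA, ?_, hAB⟩
  calc Fintype.card β ≤ 2 * D * ((4 * D) ^ m * #B) := hpopular.trans (by gcongr)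
    _ ≤ 4 * D * ((4 * D) ^ m * #B) := by gcongr; norm_num
    _ = _ := by ring

end CommonNeighbours

theorem sum_card_filter_cons_mem {n : ℕ} {X : Type*} [Fintype X] [DecidableEq X]
    (E : Finset (Fin (n + 1) → X)) :
    ∑ u : Fin n → X, #{x | (Fin.cons x u : Fin (n + 1) → X) ∈ E} = #E := by
  simp only [card_filter]
  rw [← Fintype.sum_prod_type_right' fun x u =>
    if Fin.cons (α := fun _ => X) x u ∈ E then 1 else 0]
  exact (Equiv.sum_comp (Fin.consEquiv fun _ => X) fun w => if w ∈ E then 1 else 0).trans (by simp)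

theorem exists_piFinset_subset (m k d : ℕ) :
    ∃ e, ∀ T, 2 ≤ T → ∀ (X : Type*) [Fintype X], T ^ e ≤ Fintype.card X →
      ∀ E : Finset (Fin k → X), Fintype.card X ^ k ≤ #E * T ^ d →
        ∃ A : Fin k → Finset X, (∀ i, #(A i) = m) ∧ Fintype.piFinset A ⊆ E := by
  classical
  induction k generalizing d with
  | zero =>
    refine ⟨0, fun T _ X _ _ E hE => ⟨Fin.elim0, fun i => i.elim0, fun y _ => ?_⟩⟩
    obtain ⟨u, hu⟩ : E.Nonempty := nonempty_iff_ne_empty.2 fun h => by simp [h] at hE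
    rwa [Subsingleton.elim y u]
  | succ k ih =>
    obtain ⟨e, he⟩ := ih ((d + 2) * (m + 1))
    refine ⟨max e (d + 2 + m), fun T hT X _ hX E hE => ?_⟩
    have hT1 : 1 ≤ T := by omega
    have hfour : 4 * T ^ d ≤ T ^ (d + 2) := by
      rw [pow_add, mul_comm]
      exact Nat.mul_le_mul_left _ (Nat.pow_le_pow_left hT 2)
    have hm : 4 * T ^ d * m ≤ Fintype.card X :=
      calc 4 * T ^ d * m ≤ T ^ (d + 2) * T ^ m :=
            Nat.mul_le_mul hfour (Nat.lt_two_pow_self.le.trans (Nat.pow_le_pow_left hT m))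
        _ ≤ T ^ max e (d + 2 + m) := by
            rw [← pow_add]
            exact Nat.pow_le_pow_right hT1 (le_max_right _ _)
        _ ≤ _ := hX
    have : Nonempty X := Fintype.card_pos_iff.1 (lt_of_lt_of_le (by positivity) hX)
    obtain ⟨A₀, B, hA₀, hB, hA₀B⟩ := exists_card_eq_and_card_le_pow_succ_mul
      (fun x (u : Fin k → X) => (Fin.cons x u : Fin (k + 1) → X) ∈ E) (D := T ^ d) (m := m)
      (by
        rw [sum_card_filter_cons_mem]
        simpa [pow_succ, mul_comm] using hE) hm
    obtain ⟨A, hA, hbox⟩ := he T hT X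
      (hX.trans' (Nat.pow_le_pow_right hT1 (le_max_left _ _))) B <|
      calc Fintype.card X ^ k ≤ (4 * T ^ d) ^ (m + 1) * #B := by simpa using hB
        _ ≤ T ^ ((d + 2) * (m + 1)) * #B := by
          rw [pow_mul]
          gcongr
        _ = _ := mul_comm _ _
    refine ⟨Fin.cons A₀ A, Fin.cases hA₀ hA, fun y hy => ?_⟩
    obtain ⟨h0, htail⟩ := Fin.mem_piFinset_iff_zero_tail.1 hy
    rw [← Fin.cons_self_tail y]
    exact hA₀B (y 0) h0 (Fin.tail y) (hbox htail)

end Counting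

namespace KGraph

section Basic

variable {k : ℕ} {U V W : Type*}

/-- The `k`-graph on `V` obtained by pulling back `H` along an injection of the vertices. -/
def comap (f : V ↪ W) (H : KGraph k W) : KGraph k V where
  edges := {e | e.map f ∈ H.edges}
  uniform e he := by simpa using H.uniform _ he

@[simp]
theorem mem_edges_comap {f : V ↪ W} {H : KGraph k W} {e : Finset V} :
    e ∈ (H.comap f).edges ↔ e.map f ∈ H.edges :=
  .rfl

@[simp]
theorem mem_edges_complete {n : ℕ} {e : Finset (Fin n)} : e ∈ (complete k n).edges ↔ #e = k :=
  .rfl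

theorem ContainsCopy.of_comap {f : V ↪ W} {H : KGraph k W} {F : KGraph k U}
    (h : (H.comap f).ContainsCopy F) : H.ContainsCopy F := by
  obtain ⟨g, hg⟩ := h
  exact ⟨g.trans f, fun e he => map_map g f e ▸ hg e he⟩

theorem compl_comap (f : V ↪ W) (H : KGraph k W) : (H.comap f).compl = H.compl.comap f := by
  ext e
  simp [comap, compl]

theorem ContainsCopy.trans {F : KGraph k U} {G : KGraph k V} {H : KGraph k W}
    (hGH : H.ContainsCopy G) (hFG : G.ContainsCopy F) : H.ContainsCopy F := by
  obtain ⟨f, hf⟩ := hFG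
  obtain ⟨g, hg⟩ := hGH
  exact ⟨f.trans g, fun e he => by simpa only [← map_map] using hg _ (hf e he)⟩

theorem containsCopy_or_of_embedding {X Y : Type*} {F : KGraph k U} {G : KGraph k V} (f : X ↪ Y)
    (h : ∀ R : KGraph k X, R.ContainsCopy F ∨ R.compl.ContainsCopy G) (R : KGraph k Y) :
    R.ContainsCopy F ∨ R.compl.ContainsCopy G :=
  (h (R.comap f)).imp .of_comap fun hG => .of_comap (compl_comap f R ▸ hG)

theorem arrows_of_forall_containsCopy_or {X : Type*} [Fintype X] {F : KGraph k U}
    {G : KGraph k V} {n : ℕ} (hn : Fintype.card X ≤ n)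
    (h : ∀ R : KGraph k X, R.ContainsCopy F ∨ R.compl.ContainsCopy G) : Arrows n F G :=
  containsCopy_or_of_embedding ((Fintype.equivFin X).toEmbedding.trans (Fin.castLEEmb hn)) h

theorem Arrows.card_le [Fintype V] {F : KGraph k U} {G : KGraph k V} {n : ℕ}
    (hF : F.edges.Nonempty) (h : Arrows n F G) : Fintype.card V ≤ n := by
  rcases h ⟨∅, by simp⟩ with ⟨_, hf⟩ | ⟨f, -⟩
  · exact (hf _ hF.some_mem).elim
  · simpa using Fintype.card_le_of_embedding f

theorem Arrows.arrows_ramsey {F : KGraph k U} {G : KGraph k V} {n : ℕ} (h : Arrows n F G) :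
    Arrows (ramsey F G) F G :=
  Nat.sInf_mem (s := {n | Arrows n F G}) ⟨n, h⟩

theorem Arrows.ramsey_le {F : KGraph k U} {G : KGraph k V} {n : ℕ} (h : Arrows n F G) :
    ramsey F G ≤ n :=
  Nat.sInf_le h

theorem containsCopy_complete {H : KGraph k V} {B : Finset V} {t : ℕ} (ht : t ≤ #B)
    (hB : ∀ e ⊆ B, #e = k → e ∈ H.edges) : H.ContainsCopy (complete k t) := by
  obtain ⟨f⟩ : Nonempty (Fin t ↪ B) := Function.Embedding.nonempty_of_card_le (by simpa using ht)
  refine ⟨f.trans (.subtype _), fun e he => hB _ (fun v hv => ?_) (by simpa using he)⟩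
  obtain ⟨i, -, rfl⟩ := mem_map.1 hv
  exact (f i).2

theorem exists_forall_map_notMem_of_compl_containsCopy {H : KGraph k V} {t : ℕ}
    (h : H.compl.ContainsCopy (complete k t)) :
    ∃ f : Fin t ↪ V, ∀ e : Finset (Fin t), e.map f ∉ H.edges := by
  obtain ⟨f, hf⟩ := h
  exact ⟨f, fun e he => (hf e (by simpa using H.uniform _ he)).2 he⟩

end Basic

section Triples

variable {V : Type*} [DecidableEq V] {H : KGraph 3 V} {x y z : V}

theorem ne_of_triple_mem (h : {x, y, z} ∈ H.edges) : x ≠ y ∧ x ≠ z ∧ y ≠ z := by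
  have hcard := H.uniform _ h
  refine ⟨?_, ?_, ?_⟩ <;> rintro rfl <;> revert hcard
  · simpa using (card_le_two (a := x) (b := z)).trans_lt (by norm_num) |>.ne
  · simpa [pair_comm y x] using (card_le_two (a := x) (b := y)).trans_lt (by norm_num) |>.ne
  · simpa using (card_le_two (a := x) (b := y)).trans_lt (by norm_num) |>.ne

theorem triple_rotate (x y z : V) : ({x, y, z} : Finset V) = {y, z, x} := by
  rw [insert_comm, pair_comm]

end Triples

theorem cyclicInterval_three {s : ℕ} (i : ZMod s) :
    cyclicInterval 3 s i = {i, i + 1, i + 2} := by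
  ext j
  simp [cyclicInterval, range_add_one]
  tauto

end KGraph

theorem exists_mul_pow_lt_pow {a b : ℕ} (ha : 0 < a) (hab : a < b) (c : ℕ) :
    ∃ m, c * a ^ m < b ^ m := by
  have ha' : (0 : ℝ) < a := by exact_mod_cast ha
  have hratio : (1 : ℝ) < b / a := by rw [one_lt_div ha']; exact_mod_cast hab
  obtain ⟨m, hm⟩ := pow_unbounded_of_one_lt (c : ℝ) hratio
  refine ⟨m, ?_⟩
  rw [div_pow, lt_div_iff₀ (by positivity)] at hm
  exact_mod_cast hm

namespace KGraph

section LowerBound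

variable {V : Type*}

/-- The `k`-graph of the `k`-sets whose vertices play `k` distinct roles, where `r (x, y)` is the
role that `x` has to play in every edge through `x` and `y`. A random choice of `r` gives the red
graph of the lower bound. -/
def roleGraph {k : ℕ} (r : V × V → Fin k) : KGraph k V where
  edges := {e | #e = k ∧ ∃ ρ : V → Fin k, Set.InjOn ρ e ∧
    ∀ x ∈ e, ∀ y ∈ e, x ≠ y → r (x, y) = ρ x}
  uniform _ he := he.1

theorem map_mem_edges_roleGraph {k : ℕ} {r : V × V → Fin k} {v : Fin k ↪ V}
    (h : ∀ a b, a ≠ b → r (v a, v b) = a) : univ.map v ∈ (roleGraph r).edges := by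
  refine ⟨by simp, Function.extend v id fun x => r (x, x), ?_, ?_⟩
  · simp [Set.InjOn, v.injective.extend_apply]
  · simpa [v.injective.extend_apply] using h

theorem ne_of_triple_mem_edges_roleGraph [DecidableEq V] {r : V × V → Fin 3} {x y z w : V}
    (hxyz : {x, y, z} ∈ (roleGraph r).edges) (hyzw : {y, z, w} ∈ (roleGraph r).edges) :
    r (x, y) ≠ r (y, z) ∧ r (x, y) ≠ r (z, w) := by
  obtain ⟨hxy, hxz, hyz⟩ := ne_of_triple_mem hxyz
  obtain ⟨-, -, hzw⟩ := ne_of_triple_mem hyzw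
  obtain ⟨-, ρ, hρ, hr⟩ := hxyz
  obtain ⟨-, σ, -, hs⟩ := hyzw
  have hx : r (x, y) = ρ x := hr x (by simp) y (by simp) hxy
  have hy : r (y, z) = ρ y := hr y (by simp) z (by simp) hyz
  have hz : r (z, w) = ρ z :=
    calc r (z, w) = σ z := hs z (by simp) w (by simp) hzw
      _ = r (z, y) := (hs z (by simp) y (by simp) hyz.symm).symm
      _ = ρ z := hr z (by simp) y (by simp) hyz.symm
  rw [hx, hy, hz]
  exact ⟨hρ.ne (by simp) (by simp) hxy, hρ.ne (by simp) (by simp) hxz⟩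

theorem ContainsCopy.exists_forall_triple_mem [DecidableEq V] {H : KGraph 3 V} {s : ℕ}
    {h : 3 ≤ s} (hH : H.ContainsCopy (tightCycle 3 s h)) :
    ∃ f : ZMod s → V, ∀ i, {f i, f (i + 1), f (i + 2)} ∈ H.edges := by
  obtain ⟨f, hf⟩ := hH
  refine ⟨f, fun i => ?_⟩
  simpa [cyclicInterval_three] using hf _ ⟨i, rfl⟩

theorem not_containsCopy_roleGraph {s : ℕ} (h : 3 ≤ s) (hs3 : ¬ 3 ∣ s) (r : V × V → Fin 3) :
    ¬ (roleGraph r).ContainsCopy (tightCycle 3 s h) := by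
  classical
  intro hr
  obtain ⟨f, hf⟩ := hr.exists_forall_triple_mem
  let ρ : ZMod s → Fin 3 := fun i => r (f i, f (i + 1))
  have hne : ∀ i, ρ i ≠ ρ (i + 1) ∧ ρ i ≠ ρ (i + 2) := fun i => by
    have hnext : {f (i + 1), f (i + 2), f (i + 2 + 1)} ∈ (roleGraph r).edges := by
      convert hf (i + 1) using 4 <;> ring_nf
    simpa only [ρ, add_assoc, one_add_one_eq_two] using
      ne_of_triple_mem_edges_roleGraph (hf i) hnext
  have hperiodic : Function.Periodic ρ 3 := fun i => by
    have h₀ := hne i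
    have h₁ := hne (i + 1)
    have h₂ := hne (i + 2)
    ring_nf at h₀ h₁ h₂ ⊢
    omega
  have hunit : (((3 : ZMod s)⁻¹).val : ZMod s) * 3 = 1 := by
    have : NeZero s := ⟨by omega⟩
    rw [ZMod.natCast_zmod_val, mul_comm]
    exact_mod_cast ZMod.coe_mul_inv_eq_one 3 ((Nat.prime_three.coprime_iff_not_dvd).2 hs3)
  have hone : Function.Periodic ρ 1 := hunit ▸ hperiodic.nat_mul _
  exact (hne 0).1 (hone 0).symm

section Random

variable {M : Type*}

/-- The triples of a transversal design on three copies of `M`: two distinct triples share at most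
one vertex, so that the pairs spanned by different triples are coloured independently. -/
def latinTriple [Add M] (p : M × M) : Fin 3 → M := ![p.1, p.2, p.1 + p.2]

theorem eq_of_latinTriple_eq [Add M] [IsCancelAdd M] {p q : M × M}
    {a b : Fin 3} (hab : a ≠ b) (ha : latinTriple p a = latinTriple q a)
    (hb : latinTriple p b = latinTriple q b) : p = q := by
  obtain ⟨x, y⟩ := p
  obtain ⟨x', y'⟩ := q
  fin_cases a <;> fin_cases b <;> simp_all [latinTriple]

/-- The ordered pairs of vertices spanned by the images of the Latin triples under `g`. -/
def latinPair [Add M] [IsCancelAdd M] (g : Fin 3 × M ↪ V) :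
    (M × M) × {ab : Fin 3 × Fin 3 // ab.1 ≠ ab.2} ↪ V × V where
  toFun q := (g (q.2.1.1, latinTriple q.1 q.2.1.1), g (q.2.1.2, latinTriple q.1 q.2.1.2))
  inj' := by
    rintro ⟨p, ⟨a, b⟩, hab⟩ ⟨p', ⟨a', b'⟩, hab'⟩ h
    simp only [Prod.mk.injEq, g.injective.eq_iff] at h
    obtain ⟨⟨rfl, ha⟩, rfl, hb⟩ := h
    rw [eq_of_latinTriple_eq hab ha hb]

theorem exists_forall_exists_map_mem_edges_roleGraph [Fintype V] [Fintype M] [Add M] [IsCancelAdd M]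
    (h : Fintype.card V ^ (3 * Fintype.card M) * 728 ^ (Fintype.card M * Fintype.card M) <
      729 ^ (Fintype.card M * Fintype.card M)) :
    ∃ r : V × V → Fin 3, ∀ g : Fin 3 × M ↪ V, ∃ e : Finset (Fin 3 × M),
      e.map g ∈ (roleGraph r).edges := by
  classical
  have hq : Fintype.card (Fin 3) ^ Fintype.card {ab : Fin 3 × Fin 3 // ab.1 ≠ ab.2} = 729 := by
    decide
  have hembeddings : Fintype.card (Fin 3 × M ↪ V) ≤ Fintype.card V ^ (3 * Fintype.card M) := by
    rw [Fintype.card_embedding_eq]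
    simpa using Nat.descFactorial_le_pow (Fintype.card V) (3 * Fintype.card M)
  obtain ⟨r, hr⟩ := exists_forall_exists_forall_eq
    (latinPair : (Fin 3 × M ↪ V) → _) (fun ab => ab.1.1) <| by
      rw [hq, Fintype.card_prod]
      exact h.trans_le' (by gcongr)
  refine ⟨r, fun g => ?_⟩
  obtain ⟨p, hp⟩ := hr g
  let v : Fin 3 ↪ Fin 3 × M :=
    ⟨fun a => (a, latinTriple p a), fun _ _ hab => congrArg Prod.fst hab⟩
  refine ⟨univ.map v, ?_⟩
  rw [map_map]
  exact map_mem_edges_roleGraph fun a b hab => hp ⟨(a, b), hab⟩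

end Random

theorem not_arrows_tightCycle_complete {s n m t : ℕ} (h : 3 ≤ s) (hs3 : ¬ 3 ∣ s) (hm : 0 < m)
    (hn : n ^ 3 * 728 ^ m < 729 ^ m) (ht : 3 * m ≤ t) :
    ¬ Arrows n (tightCycle 3 s h) (complete 3 t) := by
  have : NeZero m := ⟨hm.ne'⟩
  obtain ⟨r, hr⟩ := exists_forall_exists_map_mem_edges_roleGraph (V := Fin n) (M := Fin m) <| by
    simpa only [Fintype.card_fin, pow_mul, ← mul_pow] using Nat.pow_lt_pow_left hn hm.ne'
  intro hR
  obtain ⟨f, hf⟩ := exists_forall_map_notMem_of_compl_containsCopy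
    ((hR (roleGraph r)).resolve_left (not_containsCopy_roleGraph h hs3 r))
  obtain ⟨e, he⟩ := hr ((finProdFinEquiv.toEmbedding.trans (Fin.castLEEmb ht)).trans f)
  rw [← map_map] at he
  exact hf _ he

theorem exists_not_arrows_of_le_two_pow {s : ℕ} (h : 3 ≤ s) (hs3 : ¬ 3 ∣ s) :
    ∃ C, 0 < C ∧ ∀ k n t : ℕ, 0 < k → n ≤ 2 ^ k → C * k ≤ t →
      ¬ Arrows n (tightCycle 3 s h) (complete 3 t) := by
  obtain ⟨m, hm⟩ := exists_mul_pow_lt_pow (a := 728) (b := 729) (by norm_num) (by norm_num) 8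
  have hm0 : 0 < m := Nat.pos_of_ne_zero fun h => by simp [h] at hm
  refine ⟨3 * m, by omega, fun k n t hk hn ht =>
    not_arrows_tightCycle_complete h hs3 (Nat.mul_pos hm0 hk) ?_ (by rwa [← mul_assoc])⟩
  calc n ^ 3 * 728 ^ (m * k) ≤ (2 ^ k) ^ 3 * 728 ^ (m * k) := by gcongr
    _ = (8 * 728 ^ m) ^ k := by rw [mul_pow, ← pow_mul, ← pow_mul, mul_comm k 3, pow_mul 2 3]; rfl
    _ < (729 ^ m) ^ k := Nat.pow_lt_pow_left hm hk.ne'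
    _ = 729 ^ (m * k) := (pow_mul _ _ _).symm

end LowerBound

end KGraph

namespace KGraph

section Pattern

variable {V : Type*} [DecidableEq V]

/-- The union of the tight cycles `0123` and `01324`. It has closed tight walks of lengths `4` and
`5`, hence of every length which is at least `4` and not divisible by `3`. -/
def cycleFourFive : KGraph 3 (Fin 5) where
  edges := (({{0, 1, 2}, {0, 1, 3}, {0, 1, 4}, {0, 2, 3}, {0, 2, 4}, {1, 2, 3}, {2, 3, 4}} :
    Finset (Finset (Fin 5))) : Set (Finset (Fin 5)))
  uniform := by
    simp only [mem_coe]
    decide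

theorem containsCopy_cycleFourFive {R : KGraph 3 V} {a b w v z : V}
    (habw : {a, b, w} ∈ R.edges) (habv : {a, b, v} ∈ R.edges) (habz : {a, b, z} ∈ R.edges)
    (hawv : {a, w, v} ∈ R.edges) (hawz : {a, w, z} ∈ R.edges) (hbwv : {b, w, v} ∈ R.edges)
    (hwvz : {w, v, z} ∈ R.edges) : R.ContainsCopy cycleFourFive := by
  obtain ⟨hab, haw, hbw⟩ := ne_of_triple_mem habw
  obtain ⟨-, hav, hbv⟩ := ne_of_triple_mem habv
  obtain ⟨-, haz, hbz⟩ := ne_of_triple_mem habz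
  obtain ⟨hwv, hwz, hvz⟩ := ne_of_triple_mem hwvz
  refine ⟨⟨![a, b, w, v, z], fun i j hij => ?_⟩, fun e he => ?_⟩
  · fin_cases i <;> fin_cases j <;> simp_all [eq_comm]
  · simp only [cycleFourFive, coe_insert, coe_singleton, Set.mem_insert_iff,
      Set.mem_singleton_iff] at he
    rcases he with rfl | rfl | rfl | rfl | rfl | rfl | rfl <;>
      rw [map_insert, map_insert, map_singleton] <;> assumption

end Pattern

section Exposure

variable {V : Type*} [DecidableEq V] {R : KGraph 3 V}

/-- All triples with two vertices in `X` and the third one in `X ∪ S` are blue, that is, not in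
`R`, and `X` is disjoint from `S`. -/
def IsBlueOver (R : KGraph 3 V) (X S : Finset V) : Prop :=
  Disjoint X S ∧ ∀ x ∈ X, ∀ y ∈ X, ∀ z ∈ X ∪ S, {x, y, z} ∉ R.edges

namespace IsBlueOver

variable {X S S' : Finset V} {v : V}

theorem empty (R : KGraph 3 V) (S : Finset V) : IsBlueOver R ∅ S := by
  simp [IsBlueOver]

theorem mono (h : IsBlueOver R X S) (hS : S' ⊆ S) : IsBlueOver R X S' :=
  ⟨h.1.mono_right hS, fun x hx y hy z hz => h.2 x hx y hy z (union_subset_union_right hS hz)⟩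

theorem notMem (h : IsBlueOver R X S) (hv : v ∈ S) : v ∉ X :=
  disjoint_right.1 h.1 hv

theorem insert (h : IsBlueOver R X S) (hv : v ∈ S) (hS : S' ⊆ S.erase v)
    (hb : ∀ x ∈ X, ∀ z ∈ S', {x, v, z} ∉ R.edges) : IsBlueOver R (insert v X) S' := by
  have hvX : ∀ x ∈ X, ∀ y ∈ X, {x, y, v} ∉ R.edges := fun x hx y hy =>
    h.2 x hx y hy v (mem_union_right _ hv)
  have hvXS : ∀ x ∈ X, ∀ z ∈ X ∪ S', {x, v, z} ∉ R.edges := fun x hx z hz =>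
    (mem_union.1 hz).elim (fun hz => pair_comm z v ▸ hvX x hx z hz) (hb x hx z)
  refine ⟨disjoint_insert_left.2 ⟨fun hv' => by simpa using hS hv',
    h.1.mono_right (hS.trans (erase_subset _ _))⟩, fun x hx y hy z hz hxyz => ?_⟩
  obtain ⟨hxy, hxz, hyz⟩ := ne_of_triple_mem hxyz
  rw [insert_union] at hz
  rcases mem_insert.1 hx with rfl | hxX
  · rw [insert_comm] at hxyz
    exact hvXS y (mem_of_mem_insert_of_ne hy hxy.symm) z
      (mem_of_mem_insert_of_ne hz hxz.symm) hxyz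
  rcases mem_insert.1 hy with rfl | hyX
  · exact hvXS x hxX z (mem_of_mem_insert_of_ne hz hyz.symm) hxyz
  rcases mem_insert.1 hz with rfl | hzX
  · exact hvX x hxX y hyX hxyz
  · exact h.2 x hxX y hyX z
      (union_subset_union_right (hS.trans (erase_subset _ _)) hzX) hxyz

theorem containsCopy_compl (h : IsBlueOver R X S) {t : ℕ} (ht : t ≤ #X) :
    R.compl.ContainsCopy (complete 3 t) := by
  refine containsCopy_complete ht fun e heX he => ⟨he, ?_⟩
  obtain ⟨x, y, z, -, -, -, rfl⟩ := card_eq_three.1 he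
  exact h.2 x (heX (by simp)) y (heX (by simp)) z (mem_union_left _ (heX (by simp)))

theorem card_lt (h : IsBlueOver R X S) {t : ℕ}
    (hblue : ¬ R.compl.ContainsCopy (complete 3 t)) : #X < t :=
  not_le.1 fun ht => hblue (h.containsCopy_compl ht)

end IsBlueOver

/-- A state of the vertex exposure. The vertices of `reservoir` have not been exposed yet, and
every pair of exposed vertices mentioned by the other fields has the same colour towards all of
them: the pairs inside `heads`, inside a `link` and inside `apexes` are blue, the pairs of a head
and a vertex of its link are red, and each apex completes a pair of this kind to a red triangle
whose three pairs are red. -/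
structure Exposure (R : KGraph 3 V) where
  /-- the vertices not yet exposed -/
  reservoir : Finset V
  /-- the vertices which were blue to all earlier heads -/
  heads : Finset V
  /-- the exposed vertices which are red to a given head -/
  link : V → Finset V
  /-- the vertices which were red to both vertices of a red pair -/
  apexes : Finset V
  heads_blue : IsBlueOver R heads reservoir
  link_blue : ∀ a, IsBlueOver R (link a) reservoir
  apexes_blue : IsBlueOver R apexes reservoir
  link_red : ∀ a, ∀ b ∈ link a, ∀ z ∈ reservoir, {a, b, z} ∈ R.edges
  apexes_red : ∀ w ∈ apexes, ∃ a b, {a, b, w} ∈ R.edges ∧ ∀ z ∈ reservoir,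
    {a, b, z} ∈ R.edges ∧ {a, w, z} ∈ R.edges ∧ {b, w, z} ∈ R.edges

namespace Exposure

/-- The total size of the blue lists, which grows with every exposed vertex. -/
def weight (E : Exposure R) : ℕ :=
  #E.heads + #E.apexes + ∑ a ∈ E.heads, #(E.link a)

/-- The exposure in which no vertex has been exposed. -/
def initial (R : KGraph 3 V) (S : Finset V) : Exposure R where
  reservoir := S
  heads := ∅
  link _ := ∅
  apexes := ∅
  heads_blue := .empty R S
  link_blue _ := .empty R S
  apexes_blue := .empty R S
  link_red := by simp
  apexes_red := by simp

variable {E : Exposure R} {S' : Finset V} {v x y w z : V}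

theorem exists_insert_head (hv : v ∈ E.reservoir) (hS : S' ⊆ E.reservoir.erase v)
    (hblue : ∀ x ∈ E.heads, ∀ z ∈ S', {x, v, z} ∉ R.edges) :
    ∃ E' : Exposure R, E'.reservoir = S' ∧ E.weight < E'.weight := by
  have hSE : S' ⊆ E.reservoir := hS.trans (erase_subset _ _)
  refine ⟨{
    reservoir := S'
    heads := insert v E.heads
    link := E.link
    apexes := E.apexes
    heads_blue := E.heads_blue.insert hv hS hblue
    link_blue := fun a => (E.link_blue a).mono hSE
    apexes_blue := E.apexes_blue.mono hSE
    link_red := fun a b hb z hz => E.link_red a b hb z (hSE hz)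
    apexes_red := fun w hw => ?_ }, rfl, ?_⟩
  · obtain ⟨a, b, habw, hred⟩ := E.apexes_red w hw
    exact ⟨a, b, habw, fun z hz => hred z (hSE hz)⟩
  · have hvA := E.heads_blue.notMem hv
    simp only [weight, card_insert_of_notMem hvA, sum_insert hvA]
    omega

theorem exists_insert_link (hv : v ∈ E.reservoir) (hS : S' ⊆ E.reservoir.erase v)
    (hx : x ∈ E.heads) (hred : ∀ z ∈ S', {x, v, z} ∈ R.edges)
    (hblue : ∀ y ∈ E.link x, ∀ z ∈ S', {y, v, z} ∉ R.edges) :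
    ∃ E' : Exposure R, E'.reservoir = S' ∧ E.weight < E'.weight := by
  have hSE : S' ⊆ E.reservoir := hS.trans (erase_subset _ _)
  refine ⟨{
    reservoir := S'
    heads := E.heads
    link := Function.update E.link x (insert v (E.link x))
    apexes := E.apexes
    heads_blue := E.heads_blue.mono hSE
    link_blue := fun a => ?_
    apexes_blue := E.apexes_blue.mono hSE
    link_red := fun a b hb z hz => ?_
    apexes_red := fun w hw => ?_ }, rfl, ?_⟩
  · rcases eq_or_ne a x with rfl | ha
    · simpa using (E.link_blue a).insert hv hS hblue
    · simpa [ha] using (E.link_blue a).mono hSE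
  · rcases eq_or_ne a x with rfl | ha
    · rw [Function.update_self] at hb
      rcases mem_insert.1 hb with rfl | hb
      · exact hred z hz
      · exact E.link_red a b hb z (hSE hz)
    · rw [Function.update_of_ne ha] at hb
      exact E.link_red a b hb z (hSE hz)
  · obtain ⟨a, b, habw, hred⟩ := E.apexes_red w hw
    exact ⟨a, b, habw, fun z hz => hred z (hSE hz)⟩
  · refine Nat.add_lt_add_left (sum_lt_sum (fun a _ => card_le_card ?_) ⟨x, hx, ?_⟩) _
    · rcases eq_or_ne a x with rfl | ha <;> simp [*]
    · simp [(E.link_blue x).notMem hv]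

theorem exists_insert_apex (hv : v ∈ E.reservoir) (hS : S' ⊆ E.reservoir.erase v)
    (hy : y ∈ E.link x) (hxred : ∀ z ∈ S', {x, v, z} ∈ R.edges)
    (hyred : ∀ z ∈ S', {y, v, z} ∈ R.edges)
    (hblue : ∀ w ∈ E.apexes, ∀ z ∈ S', {w, v, z} ∉ R.edges) :
    ∃ E' : Exposure R, E'.reservoir = S' ∧ E.weight < E'.weight := by
  have hSE : S' ⊆ E.reservoir := hS.trans (erase_subset _ _)
  refine ⟨{
    reservoir := S'
    heads := E.heads
    link := E.link
    apexes := insert v E.apexes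
    heads_blue := E.heads_blue.mono hSE
    link_blue := fun a => (E.link_blue a).mono hSE
    apexes_blue := E.apexes_blue.insert hv hS hblue
    link_red := fun a b hb z hz => E.link_red a b hb z (hSE hz)
    apexes_red := fun w hw => ?_ }, rfl, ?_⟩
  · rcases mem_insert.1 hw with rfl | hw
    · exact ⟨x, y, E.link_red x y hy w hv,
        fun z hz => ⟨E.link_red x y hy z (hSE hz), hxred z hz, hyred z hz⟩⟩
    · obtain ⟨a, b, habw, hred⟩ := E.apexes_red w hw
      exact ⟨a, b, habw, fun z hz => hred z (hSE hz)⟩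
  · simp only [weight, card_insert_of_notMem (E.apexes_blue.notMem hv)]
    omega

theorem containsCopy_of_mem_apexes (hw : w ∈ E.apexes) (hv : v ∈ E.reservoir)
    (hz : z ∈ E.reservoir) (hwvz : {w, v, z} ∈ R.edges) : R.ContainsCopy cycleFourFive := by
  obtain ⟨a, b, habw, hred⟩ := E.apexes_red w hw
  obtain ⟨habv, hawv, hbwv⟩ := hred v hv
  obtain ⟨habz, hawz, -⟩ := hred z hz
  exact containsCopy_cycleFourFive habw habv habz hawv hawz hbwv hwvz

theorem weight_lt_sq (E : Exposure R) {t : ℕ} (hblue : ¬ R.compl.ContainsCopy (complete 3 t)) :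
    E.weight < t ^ 2 := by
  obtain ⟨u, rfl⟩ : ∃ u, t = u + 1 :=
    Nat.exists_eq_succ_of_ne_zero (E.heads_blue.card_lt hblue).ne_bot
  have hheads : #E.heads ≤ u := Nat.le_of_lt_succ (E.heads_blue.card_lt hblue)
  have hapexes : #E.apexes ≤ u := Nat.le_of_lt_succ (E.apexes_blue.card_lt hblue)
  have hlinks : ∑ a ∈ E.heads, #(E.link a) ≤ #E.heads * u :=
    sum_le_card_nsmul _ _ _ fun a _ => Nat.le_of_lt_succ ((E.link_blue a).card_lt hblue)
  calc E.weight ≤ u + u + u * u := by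
        unfold weight
        gcongr
        exact hlinks.trans (by gcongr)
    _ < (u + 1) ^ 2 := by linarith

open scoped Classical in
theorem exists_weight_lt (E : Exposure R) {t : ℕ} (ht : 2 ≤ t) (hS : 2 ≤ #E.reservoir)
    (hred : ¬ R.ContainsCopy cycleFourFive) (hblue : ¬ R.compl.ContainsCopy (complete 3 t)) :
    ∃ E' : Exposure R, E.weight < E'.weight ∧ #E.reservoir ≤ t ^ 3 * #E'.reservoir := by
  obtain ⟨v, hv⟩ : E.reservoir.Nonempty := card_pos.1 (by omega)
  let r : V → V → Prop := fun x z => {x, v, z} ∈ R.edges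
  have hapexes : ∀ S ⊆ E.reservoir.erase v, ∀ w ∈ E.apexes, ∀ z ∈ S, ¬ r w z :=
    fun S hS w hw z hz hwvz =>
      hred (containsCopy_of_mem_apexes hw hv (mem_of_mem_erase (hS hz)) hwvz)
  have hv_card : #E.reservoir ≤ t * #(E.reservoir.erase v) :=
    calc #E.reservoir ≤ 2 * #(E.reservoir.erase v) := by rw [card_erase_of_mem hv]; omega
      _ ≤ t * #(E.reservoir.erase v) := by gcongr
  suffices ∃ S ⊆ E.reservoir.erase v, #(E.reservoir.erase v) ≤ t * (t * #S) ∧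
      ∃ E' : Exposure R, E'.reservoir = S ∧ E.weight < E'.weight by
    obtain ⟨_, -, hcard, E', rfl, hweight⟩ := this
    refine ⟨E', hweight, hv_card.trans ?_⟩
    calc t * #(E.reservoir.erase v) ≤ t * (t * (t * #E'.reservoir)) := by gcongr
      _ = t ^ 3 * #E'.reservoir := by ring
  rcases exists_card_le_mul_card_filter_or r E.heads (E.reservoir.erase v)
    (E.heads_blue.card_lt hblue) with ⟨x, hx, hxcard⟩ | hheads
  · rcases exists_card_le_mul_card_filter_or r (E.link x) {z ∈ E.reservoir.erase v | r x z}
      ((E.link_blue x).card_lt hblue) with ⟨y, hy, hycard⟩ | hlink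
    · have hsub := (filter_subset (r y) _).trans (filter_subset (r x) (E.reservoir.erase v))
      exact ⟨_, hsub, hxcard.trans (by gcongr), exists_insert_apex hv hsub hy
        (fun z hz => (mem_filter.1 (mem_filter.1 hz).1).2) (fun z hz => (mem_filter.1 hz).2)
        (hapexes _ hsub)⟩
    · have hsub := (filter_subset (fun z => ∀ y ∈ E.link x, ¬ r y z) _).trans
        (filter_subset (r x) (E.reservoir.erase v))
      exact ⟨_, hsub, hxcard.trans (by gcongr), exists_insert_link hv hsub hx
        (fun z hz => (mem_filter.1 (mem_filter.1 hz).1).2)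
        (fun y hy z hz => (mem_filter.1 hz).2 y hy)⟩
  · have hsub := filter_subset (fun z => ∀ x ∈ E.heads, ¬ r x z) (E.reservoir.erase v)
    exact ⟨_, hsub, hheads.trans (by gcongr; exact Nat.le_mul_of_pos_left _ (by omega)),
      exists_insert_head hv hsub fun x hx z hz => (mem_filter.1 hz).2 x hx⟩

theorem exists_le_weight [Fintype V] {t : ℕ} (ht : 2 ≤ t)
    (hred : ¬ R.ContainsCopy cycleFourFive) (hblue : ¬ R.compl.ContainsCopy (complete 3 t))
    (n : ℕ) (hV : (t ^ 3) ^ n ≤ Fintype.card V) :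
    ∃ E : Exposure R, n ≤ E.weight ∧ Fintype.card V ≤ (t ^ 3) ^ n * #E.reservoir := by
  induction n with
  | zero => exact ⟨initial R univ, by simp [initial]⟩
  | succ n ih =>
    rw [pow_succ] at hV
    obtain ⟨E, hweight, hcard⟩ := ih (hV.trans' (Nat.le_mul_of_pos_right _ (by positivity)))
    have hreservoir : t ^ 3 ≤ #E.reservoir :=
      Nat.le_of_mul_le_mul_left (hV.trans hcard) (by positivity)
    obtain ⟨E', hlt, hcard'⟩ := E.exists_weight_lt ht
      (ht.trans ((Nat.le_self_pow (by norm_num) t).trans hreservoir)) hred hblue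
    refine ⟨E', by omega, hcard.trans ?_⟩
    rw [pow_succ (t ^ 3), mul_assoc]
    gcongr

end Exposure

theorem arrows_cycleFourFive_complete {t : ℕ} (ht : 2 ≤ t) :
    Arrows ((t ^ 3) ^ t ^ 2) cycleFourFive (complete 3 t) := by
  intro R
  by_contra! ⟨hred, hblue⟩
  obtain ⟨E, hE, -⟩ := Exposure.exists_le_weight ht hred hblue (t ^ 2) (by simp)
  exact (E.weight_lt_sq hblue).not_ge hE

end Exposure

section Homomorphism

variable {k : ℕ} {V W α X : Type*}

/-- The graph of `y` over the vertices chosen by `p`, as an injection into the product. -/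
def pairEmbedding (p : V ↪ α) (y : V → X) : V ↪ α × X :=
  ⟨fun l => (p l, y l), fun _ _ h => p.injective (congrArg Prod.fst h)⟩

theorem containsCopy_of_piFinset [Fintype V] [DecidableEq V] [Fintype W] [Nonempty W]
    {F : KGraph k V} {G : KGraph k W} {R : KGraph k (α × X)} {φ : W → V}
    (hφ : ∀ e ∈ G.edges, e.image φ ∈ F.edges) (p : V ↪ α) {A : V → Finset X}
    (hA : ∀ l, #(A l) = Fintype.card W)
    (hR : ∀ y ∈ Fintype.piFinset A, ∀ e ∈ F.edges, e.map (pairEmbedding p y) ∈ R.edges) :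
    R.ContainsCopy G := by
  classical
  let a (l : V) : W ≃ A l := Fintype.equivOfCardEq (by simp [hA])
  let f : W ↪ α × X := ⟨fun w => (p (φ w), a (φ w) w), fun w w' h => by
    obtain ⟨hfst, hsnd⟩ := Prod.mk.inj h
    rw [← p.injective hfst] at hsnd
    exact (a _).injective (Subtype.ext hsnd)⟩
  refine ⟨f, fun e he => ?_⟩
  have hinj : Set.InjOn φ e := card_image_iff.1 <| by rw [F.uniform _ (hφ e he), G.uniform _ he]
  let y (l : V) : X := a l (Function.invFunOn φ e l)
  have hy : y ∈ Fintype.piFinset A := Fintype.mem_piFinset.2 fun l => (a l _).2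
  convert hR y hy _ (hφ e he) using 1
  rw [map_eq_image, map_eq_image, image_image]
  refine image_congr fun w hw => Prod.ext rfl ?_
  exact congrArg (fun u => (a (φ w) u : X)) (hinj.leftInvOn_invFunOn hw).symm

theorem exists_arrows_pow_of_image_mem_edges [Finite W] [Nonempty W] {v : ℕ}
    {F : KGraph k (Fin v)} {G : KGraph k W} {φ : W → Fin v}
    (hφ : ∀ e ∈ G.edges, e.image φ ∈ F.edges) :
    ∃ d, ∀ N, 2 ≤ N → ∀ (U : Type*) (H : KGraph k U), Arrows N F H → Arrows (N ^ d) G H := by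
  classical
  cases nonempty_fintype W
  obtain ⟨d, hd⟩ := exists_piFinset_subset (Fintype.card W) v v
  refine ⟨1 + d, fun N hN U H h =>
    arrows_of_forall_containsCopy_or (X := Fin N × Fin (N ^ d)) (by simp [pow_add]) fun R => ?_⟩
  refine or_iff_not_imp_right.2 fun hblue => ?_
  let E (p : Fin v ↪ Fin N) : Finset (Fin v → Fin (N ^ d)) :=
    {y | ∀ e ∈ F.edges, e.map (pairEmbedding p y) ∈ R.edges}
  have : NeZero (N ^ d) := ⟨by positivity⟩
  obtain ⟨p, hp⟩ := exists_card_pow_le_card_mul E fun g => by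
    obtain ⟨p, hp⟩ := (h (R.comap (pairEmbedding (.refl _) g))).resolve_right fun hH =>
      hblue (.of_comap (compl_comap _ R ▸ hH))
    refine ⟨p, mem_filter.2 ⟨mem_univ _, fun e he => ?_⟩⟩
    have := hp e he
    rwa [mem_edges_comap, map_map] at this
  obtain ⟨A, hA, hAE⟩ := hd N hN (Fin (N ^ d)) (by simp) (E p) (by simpa using hp)
  exact containsCopy_of_piFinset hφ p hA fun y hy => (mem_filter.1 (hAE hy)).2

end Homomorphism

section TightWalk

variable {V : Type*} [DecidableEq V] {F : KGraph 3 V} {s : ℕ} {w : ℕ → V}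

/-- The sequence `w 0, …, w s, w (s + 1)` is a closed tight walk of length `s` in `F`: it returns
to its first two vertices, and any three consecutive vertices form an edge. -/
def IsClosedTightWalk (F : KGraph 3 V) (s : ℕ) (w : ℕ → V) : Prop :=
  w s = w 0 ∧ w (s + 1) = w 1 ∧ ∀ n < s, {w n, w (n + 1), w (n + 2)} ∈ F.edges

theorem IsClosedTightWalk.exists_add_three (hs : 0 < s) (h : IsClosedTightWalk F s w) :
    ∃ w', IsClosedTightWalk F (s + 3) w' := by
  obtain ⟨h0, h1, hedge⟩ := h
  refine ⟨fun | 0 => w 0 | 1 => w 1 | 2 => w 2 | n + 3 => w n, h0, h1, fun n hn => ?_⟩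
  match n with
  | 0 => exact hedge 0 hs
  | 1 => exact triple_rotate (w 0) _ _ ▸ hedge 0 hs
  | 2 => exact triple_rotate (w 2) _ _ ▸ hedge 0 hs
  | n + 3 => exact hedge n (by omega)

theorem exists_isClosedTightWalk_cycleFourFive (h : 4 ≤ s) (hs3 : ¬ 3 ∣ s) :
    ∃ w, IsClosedTightWalk cycleFourFive s w := by
  induction s using Nat.strong_induction_on with
  | _ s ih =>
    rcases (by omega : s = 4 ∨ s = 5 ∨ 7 ≤ s) with rfl | rfl | hs
    · exact ⟨fun n => ![0, 1, 2, 3, 0, 1] (Fin.ofNat 6 n), by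
        simp only [IsClosedTightWalk, cycleFourFive, mem_coe]; decide⟩
    · exact ⟨fun n => ![0, 1, 3, 2, 4, 0, 1] (Fin.ofNat 7 n), by
        simp only [IsClosedTightWalk, cycleFourFive, mem_coe]; decide⟩
    · obtain ⟨w, hw⟩ := ih (s - 3) (by omega) (by omega) (by omega)
      simpa only [Nat.sub_add_cancel (by omega : 3 ≤ s)] using hw.exists_add_three (by omega)

theorem IsClosedTightWalk.image_val_mem_edges (h : 3 ≤ s) (hw : IsClosedTightWalk F s w) :
    ∀ e ∈ (tightCycle 3 s h).edges, e.image (fun i => w i.val) ∈ F.edges := by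
  rintro _ ⟨i, rfl⟩
  have : NeZero s := ⟨by omega⟩
  have hmod : ∀ n ≤ s + 1, w (n % s) = w n := fun n hn => by
    rcases (by omega : n < s ∨ n = s ∨ n = s + 1) with hlt | rfl | rfl
    · rw [Nat.mod_eq_of_lt hlt]
    · simpa using hw.1.symm
    · simpa [Nat.mod_eq_of_lt (by omega : 1 < s)] using hw.2.1.symm
  have hval : ∀ j : ℕ, j ≤ 2 → w (i + j).val = w (i.val + j) := fun j hj => by
    rw [ZMod.val_add, ZMod.val_natCast, Nat.add_mod_mod, hmod _ (by have := i.val_lt; omega)]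
  have h1 := hval 1 (by norm_num)
  have h2 := hval 2 (by norm_num)
  push_cast at h1 h2
  simpa [cyclicInterval_three, image_insert, h1, h2] using hw.2.2 i.val i.val_lt

end TightWalk

theorem exists_arrows_tightCycle_complete {s : ℕ} (h : 3 ≤ s) (hs3 : ¬ 3 ∣ s) :
    ∃ d, ∀ t, 2 ≤ t → Arrows ((t ^ t ^ 2) ^ d) (tightCycle 3 s h) (complete 3 t) := by
  have : NeZero s := ⟨by omega⟩
  obtain ⟨w, hw⟩ := exists_isClosedTightWalk_cycleFourFive (by omega : 4 ≤ s) hs3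
  obtain ⟨d, hd⟩ := exists_arrows_pow_of_image_mem_edges (hw.image_val_mem_edges h)
  refine ⟨3 * d, fun t ht => ?_⟩
  have hN : 2 ≤ (t ^ 3) ^ t ^ 2 :=
    ht.trans ((Nat.le_self_pow (by norm_num) t).trans (Nat.le_self_pow (by positivity) _))
  rw [pow_mul, pow_right_comm t]
  exact hd _ hN _ _ (arrows_cycleFourFive_complete ht)

section RamseyNumber

variable {s : ℕ}

theorem exists_two_rpow_lt_of_arrows (h : 3 ≤ s) (hs3 : ¬ 3 ∣ s) :
    ∃ a : ℝ, 0 < a ∧ ∀ t n : ℕ, 2 ≤ t → Arrows n (tightCycle 3 s h) (complete 3 t) →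
      (2 : ℝ) ^ (a * t) < n := by
  obtain ⟨C, hC, hlower⟩ := exists_not_arrows_of_le_two_pow h hs3
  refine ⟨1 / (2 * C), by positivity, fun t n ht hn => ?_⟩
  rcases lt_or_ge t C with htC | htC
  · have htn : t ≤ n := by
      simpa using Arrows.card_le (F := tightCycle 3 s h) ⟨_, 0, rfl⟩ hn
    calc (2 : ℝ) ^ (1 / (2 * C) * t : ℝ) < 2 ^ (1 : ℝ) := by
          refine Real.rpow_lt_rpow_of_exponent_lt (by norm_num) ?_
          rw [one_div_mul_eq_div, div_lt_one (by positivity)]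
          exact_mod_cast (by omega : t < 2 * C)
      _ = 2 := Real.rpow_one 2
      _ ≤ n := by exact_mod_cast ht.trans htn
  · have hquot : t ≤ 2 * C * (t / C) := by
      have := Nat.div_pos htC hC
      nlinarith [Nat.lt_mul_div_succ t hC]
    have hlt : 2 ^ (t / C) < n := not_le.1 fun hle =>
      hlower (t / C) n t (Nat.div_pos htC hC) hle (Nat.mul_div_le t C) hn
    calc (2 : ℝ) ^ (1 / (2 * C) * t : ℝ) ≤ 2 ^ ((t / C : ℕ) : ℝ) := by
          refine Real.rpow_le_rpow_of_exponent_le (by norm_num) ?_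
          rw [one_div_mul_eq_div, div_le_iff₀' (by positivity)]
          exact_mod_cast hquot
      _ < n := by
          rw [Real.rpow_natCast]
          exact_mod_cast hlt

theorem two_rpow_div_log_two_mul_log {t : ℕ} (ht : 0 < t) (c m : ℕ) :
    (2 : ℝ) ^ (c / Real.log 2 * (m : ℝ) * Real.log t) = (t ^ m) ^ c := by
  have hlog : Real.log 2 ≠ 0 := (Real.log_pos one_lt_two).ne'
  have hexp : Real.log 2 * (c / Real.log 2 * m * Real.log t) = Real.log t * (m * c : ℕ) := by
    push_cast
    field_simp
  rw [Real.rpow_def_of_pos two_pos, hexp, ← Real.rpow_def_of_pos (by exact_mod_cast ht),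
    Real.rpow_natCast, pow_mul]

theorem exists_ramsey_lt_two_rpow (h : 3 ≤ s) (hs3 : ¬ 3 ∣ s) :
    ∃ b : ℝ, 0 < b ∧ ∀ t : ℕ, 2 ≤ t →
      (ramsey (tightCycle 3 s h) (complete 3 t) : ℝ) <
        2 ^ (b * (t : ℝ) ^ 2 * Real.log t) := by
  obtain ⟨d, hd⟩ := exists_arrows_tightCycle_complete h hs3
  refine ⟨(d + 1 : ℕ) / Real.log 2, by positivity, fun t ht => ?_⟩
  have hbase : 2 ≤ t ^ t ^ 2 := ht.trans (Nat.le_self_pow (by positivity) t)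
  rw [← Nat.cast_pow t 2, two_rpow_div_log_two_mul_log (by omega)]
  exact_mod_cast (hd t ht).ramsey_le.trans_lt (Nat.pow_lt_pow_right hbase (Nat.lt_succ_self d))

end RamseyNumber

end KGraph

open KGraph in
theorem theorem1_general (s : ℕ) (h : 3 ≤ s) (hs3 : ¬ 3 ∣ s) :
    ∃ a b : ℝ, 0 < a ∧ 0 < b ∧ ∀ t : ℕ, 2 ≤ t →
      (2 : ℝ) ^ (a * (t : ℝ)) < (ramsey (tightCycle 3 s h) (complete 3 t) : ℝ) ∧
        (ramsey (tightCycle 3 s h) (complete 3 t) : ℝ) <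
          (2 : ℝ) ^ (b * (t : ℝ) ^ 2 * Real.log (t : ℝ)) := by
  obtain ⟨d, hd⟩ := exists_arrows_tightCycle_complete h hs3
  obtain ⟨a, ha, hlower⟩ := exists_two_rpow_lt_of_arrows h hs3
  obtain ⟨b, hb, hupper⟩ := exists_ramsey_lt_two_rpow h hs3
  exact ⟨a, b, ha, hb, fun t ht => ⟨hlower t _ ht (hd t ht).arrows_ramsey, hupper t ht⟩⟩

theorem theorem1 (s : ℕ) (hs : 5 ≤ s) (hs3 : ¬ 3 ∣ s) :
    ∃ a b : ℝ, 0 < a ∧ 0 < b ∧ ∀ t : ℕ, 2 ≤ t →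
      (2 : ℝ) ^ (a * (t : ℝ)) <
          (KGraph.ramsey (KGraph.tightCycle 3 s (le_trans (by norm_num) hs))
            (KGraph.complete 3 t) : ℝ) ∧
        (KGraph.ramsey (KGraph.tightCycle 3 s (le_trans (by norm_num) hs))
            (KGraph.complete 3 t) : ℝ) <
          (2 : ℝ) ^ (b * (t : ℝ) ^ 2 * Real.log (t : ℝ)) :=
  theorem1_general s _ hs3
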